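/- Let $S$ be a semigroup with zero which is categorical at zero, that is, for all $x,y,z\in S$, $xyz=0$ implies $xy=0$ or $yz=0$. Let $A$ be any $0$-module over $S$, that is, an abelian group with a multiplication $A\times(S\setminus 0)\to A$ such that $(a+b)s=as+bs$ for all $a,b\in A$, $s\in S\setminus 0$, and $(as)t=a(st)$ for all $a\in A$ and $s,t\in S\setminus 0$ with $st\neq 0$. Let $C^0_n(S,A)$ ($n\ge 1$) be the group of finite linear combinations, with coefficients in $A$, of the $n$-tuples $[s_1,\dots,s_n]$ of elements of $S$ with $s_1s_2\cdots s_n\neq 0$, let $C^0_0(S,A)=A$, and let $$\partial_n(a[s_1,\dots,s_n])=as_1[s_2,\dots,s_n]+\sum_{i=1}^{n-1}(-1)^i a[s_1,\dots,s_is_{i+1},\dots,s_n]+(-1)^n a[s_1,\dots,s_{n-1}]\quad(n\ge 2),\qquad \partial_1(a[s])=as-a.$$ The homology groups of this complex are the $0$-homology groups $H^0_n(S,A)$, $n\ge 0$; in particular $H^0_0(S,A)=A/\operatorname{Im}\partial_1$. Let $\bar S$ be the $0$-reflector of $S$, that is, the semigroup generated by symbols $\langle s\rangle$ for $s\in S\setminus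 0$, subject to the relations $\langle s\rangle\langle t\rangle=\langle st\rangle$ for all $s,t\in S\setminus 0$ with $st\neq 0$; equivalently, $s\mapsto\langle s\rangle$ is the universal map from $S\setminus 0$ to a semigroup that preserves all nonzero products. Then $A$ is a right $\bar S$-module by $a\langle s_1\rangle\cdots\langle s_k\rangle=(\dots(as_1)\dots)s_k$. Let $H_n(\bar S,A)$, $n\ge 0$, be the homology groups of the complex $C_*(\bar S,A)$, where $C_n(\bar S,A)$ ($n\ge 1$) is the group of finite linear combinations, with coefficients in $A$, of all $n$-tuples $[x_1,\dots,x_n]$ of elements of $\bar S$, $C_0(\bar S,A)=A$, and the boundary is given by the same formulas. Let $\varepsilon:C^0_*(S,A)\to C_*(\bar S,A)$ be the chain map with $\varepsilon_n(a[s_1,\dots,s_n])=a[\langle s_1\rangle,\dots,\langle s_n\rangle]$ for $n\geq 1$ and $\varepsilon_0=\mathrm{id}_A$. Then for every $n\ge 0$ the induced homomorphism $\varepsilon_n^{*}:H^0_n(S,A)\to H_n(\bar S,A)$ is an isomorphism. -/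

import Mathlib

open CategoryTheory

/-! ### Modules and 0-modules -/

/-- A semigroup with zero is categorical at zero if `xyz = 0` implies `xy = 0` or `yz = 0`. -/
def CategoricalAtZero (S : Type*) [SemigroupWithZero S] : Prop :=
  ∀ x y z : S, x * y * z = 0 → x * y = 0 ∨ y * z = 0

/-- A right module over a semigroup `T`: an abelian group `A` with an action `A × T → A`
such that `(a + b)t = at + bt` and `(as)t = a(st)`. -/
class RightModule (T : Type*) [Semigroup T] (A : Type*) [AddCommGroup A] where
  act : A → T → A
  add_act : ∀ (a b : A) (t : T), act (a + b) t = act a t + act b t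
  act_mul : ∀ (a : A) (s t : T), act (act a s) t = act a (s * t)

/-- A 0-module over a semigroup with zero `S`: an abelian group `A` with a multiplication
`A × (S \ 0) → A` such that `(a + b)s = as + bs`, and `(as)t = a(st)` whenever `st ≠ 0`. -/
class ZeroModule (S : Type*) [SemigroupWithZero S] (A : Type*) [AddCommGroup A] where
  act : A → {s : S // s ≠ 0} → A
  add_act : ∀ (a b : A) (s : {s : S // s ≠ 0}), act (a + b) s = act a s + act b s
  act_mul : ∀ (a : A) (s t : {s : S // s ≠ 0}) (h : s.1 * t.1 ≠ 0),
    act (act a s) t = act a ⟨s.1 * t.1, h⟩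

/-- The action of an element of `T` as an additive endomorphism. -/
def RightModule.actHom {T : Type*} [Semigroup T] (A : Type*) [AddCommGroup A] [RightModule T A]
    (t : T) : A →+ A :=
  AddMonoidHom.mk' (fun a => RightModule.act a t) fun a b => RightModule.add_act a b t

/-- The action of a nonzero element of `S` as an additive endomorphism. -/
def ZeroModule.actHom {S : Type*} [SemigroupWithZero S] (A : Type*) [AddCommGroup A]
    [ZeroModule S A] (s : {s : S // s ≠ 0}) : A →+ A :=
  AddMonoidHom.mk' (fun a => ZeroModule.act a s) fun a b => ZeroModule.add_act a b s

/-! ### The 0-reflector -/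

section Reflector

variable (S : Type*) [SemigroupWithZero S]

/-- The relations `s · t = st`, for `s, t ∈ S \ 0` with `st ≠ 0`, between words in the nonzero
elements of `S`. -/
inductive ReflectorRel :
    FreeSemigroup {s : S // s ≠ 0} → FreeSemigroup {s : S // s ≠ 0} → Prop
  | mul (s t : {s : S // s ≠ 0}) (h : s.1 * t.1 ≠ 0) :
      ReflectorRel (FreeSemigroup.of s * FreeSemigroup.of t)
        (FreeSemigroup.of ⟨s.1 * t.1, h⟩)

/-- The 0-reflector of `S`: the semigroup generated by the nonzero elements of `S`, subject to
the non-zero relations of the multiplication table of `S`. -/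
abbrev Reflector : Type _ := (conGen (ReflectorRel S)).Quotient

variable {S}

/-- The canonical map `s ↦ ⟨s⟩` from `S \ 0` to the 0-reflector. -/
def Reflector.of (s : {s : S // s ≠ 0}) : Reflector S :=
  ((FreeSemigroup.of s : FreeSemigroup {s : S // s ≠ 0}) : (conGen (ReflectorRel S)).Quotient)

theorem Reflector.of_mul_of (s t : {s : S // s ≠ 0}) (h : s.1 * t.1 ≠ 0) :
    Reflector.of s * Reflector.of t = Reflector.of ⟨s.1 * t.1, h⟩ :=
  (Con.eq _).2 (ConGen.Rel.of _ _ (ReflectorRel.mul s t h))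

/-- A map on `S \ 0` which is multiplicative on pairs with nonzero product induces a semigroup
homomorphism on the 0-reflector. -/
def Reflector.lift {T : Type*} [Semigroup T] (φ : {s : S // s ≠ 0} → T)
    (hφ : ∀ (s t : {s : S // s ≠ 0}) (h : s.1 * t.1 ≠ 0), φ ⟨s.1 * t.1, h⟩ = φ s * φ t) :
    Reflector S →ₙ* T where
  toFun x := Con.liftOn x (FreeSemigroup.lift φ) fun v w hvw => by
    have hle : conGen (ReflectorRel S) ≤ Con.ker (FreeSemigroup.lift φ) := by
      refine Con.conGen_le.2 ?_
      rintro _ _ ⟨s, t, h⟩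
      simp [Con.ker_rel, hφ s t h]
    exact hle hvw
  map_mul' x y := by
    induction x using Con.induction_on
    induction y using Con.induction_on
    exact map_mul (FreeSemigroup.lift φ) _ _

@[simp]
theorem Reflector.lift_of {T : Type*} [Semigroup T] (φ : {s : S // s ≠ 0} → T)
    (hφ : ∀ (s t : {s : S // s ≠ 0}) (h : s.1 * t.1 ≠ 0), φ ⟨s.1 * t.1, h⟩ = φ s * φ t)
    (s : {s : S // s ≠ 0}) : Reflector.lift φ hφ (Reflector.of s) = φ s :=
  FreeSemigroup.lift_of φ s

/-- The universal property of the 0-reflector: every 0-homomorphism from `S` to a semigroup `T`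
with an adjoined zero, that is, every map `S \ 0 → T` which is multiplicative on pairs with
nonzero product, factors uniquely through the 0-reflector. -/
theorem Reflector.existsUnique_lift {T : Type*} [Semigroup T] (φ : {s : S // s ≠ 0} → T)
    (hφ : ∀ (s t : {s : S // s ≠ 0}) (h : s.1 * t.1 ≠ 0), φ ⟨s.1 * t.1, h⟩ = φ s * φ t) :
    ∃! f : Reflector S →ₙ* T, ∀ s, f (Reflector.of s) = φ s := by
  refine ⟨Reflector.lift φ hφ, Reflector.lift_of φ hφ, fun f hf => ?_⟩
  ext x
  induction x using Con.induction_on with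
  | _ w =>
    induction w using FreeSemigroup.recOnMul with
    | ih1 s => exact (hf s).trans (Reflector.lift_of φ hφ s).symm
    | ih2 s w hs hw => rw [Con.coe_mul, map_mul, map_mul, hs, hw]

/-- A 0-module over `S` is a module over the 0-reflector:
`a⟨s₁, …, sₙ⟩ = (…(as₁)s₂…)sₙ`. -/
instance ZeroModule.toReflector (A : Type*) [AddCommGroup A] [ZeroModule S A] :
    RightModule (Reflector S) A where
  act a x := (Reflector.lift (T := (AddMonoid.End A)ᵐᵒᵖ)
    (fun s => MulOpposite.op (ZeroModule.actHom A s : AddMonoid.End A)) (fun s t h => by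
      refine congrArg MulOpposite.op (AddMonoidHom.ext fun a => ?_)
      exact (ZeroModule.act_mul a s t h).symm) x).unop a
  add_act a b x := map_add _ a b
  act_mul a x y := by rw [map_mul]; rfl

theorem Reflector.act_of {A : Type*} [AddCommGroup A] [ZeroModule S A] (a : A)
    (s : {s : S // s ≠ 0}) :
    RightModule.act a (Reflector.of s) = ZeroModule.act a s := by
  change (Reflector.lift (T := (AddMonoid.End A)ᵐᵒᵖ) _ _ (Reflector.of s)).unop a = _
  rw [Reflector.lift_of]
  rfl

end Reflector

/-! ### Faces of tuples -/

/-- If the faces satisfy the presimplicial identities, then two consecutive alternating sums of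
faces compose to zero. -/
theorem sum_faces_sq {L M N : Type*} [AddCommGroup L] [AddCommGroup M] [AddCommGroup N] (n : ℕ)
    (d : Fin (n + 2) → M →+ N) (e : Fin (n + 3) → L →+ M)
    (h : ∀ i j : Fin (n + 2), i ≤ j → ∀ x, d i (e j.succ x) = d j (e i.castSucc x)) (x : L) :
    ∑ i : Fin (n + 2), (-1 : ℤ) ^ (i : ℕ) • d i (∑ j : Fin (n + 3), (-1 : ℤ) ^ (j : ℕ) • e j x) = 0 := by
  simp only [map_sum, map_zsmul, Finset.smul_sum, smul_smul, ← pow_add]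
  rw [← Finset.sum_product']
  let P := Fin (n + 2) × Fin (n + 3)
  let Q : Finset P := {ij : P | (ij.2 : ℕ) ≤ (ij.1 : ℕ)}
  rw [Finset.univ_product_univ, ← Finset.sum_add_sum_compl Q, ← eq_neg_iff_add_eq_zero,
    ← Finset.sum_neg_distrib]
  let φ : ∀ ij : P, ij ∈ Q → P := fun ij hij =>
    (Fin.castLT ij.2 (lt_of_le_of_lt (Finset.mem_filter.mp hij).right (Fin.is_lt ij.1)), ij.1.succ)
  apply Finset.sum_bij φ
  · intro ij hij
    simp_rw [Q, φ, Finset.compl_filter, Finset.mem_filter_univ, Fin.val_succ,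
      Fin.val_castLT] at hij ⊢
    lia
  · rintro ⟨i, j⟩ hij ⟨i', j'⟩ hij' h
    have h1 := congrArg (fun p : P => ((p.1 : ℕ), (p.2 : ℕ))) h
    simp only [φ, Prod.mk.injEq, Fin.val_castLT, Fin.val_succ] at h1
    exact Prod.ext (Fin.ext (by simpa using h1.2)) (Fin.ext h1.1)
  · rintro ⟨i', j'⟩ hij'
    simp_rw [Q, Finset.compl_filter, Finset.mem_filter_univ, not_le] at hij'
    refine ⟨(j'.pred <| ?_, Fin.castSucc i'), ?_, ?_⟩
    · rintro rfl
      simp only [Fin.val_zero, not_lt_zero] at hij'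
    · simpa [Q] using Nat.le_sub_one_of_lt hij'
    · simp only [φ, Fin.castLT_castSucc, Fin.succ_pred]
  · rintro ⟨i, j⟩ hij
    have hle : (j : ℕ) ≤ i := by simpa [Q] using hij
    have := h (Fin.castLT j (lt_of_le_of_lt hle i.2)) i hle x
    simp only [φ, Fin.castSucc_castLT, Fin.val_castLT, Fin.val_succ] at this ⊢
    rw [this, ← neg_smul]
    congr 1
    ring

theorem tail_contractNth_zero {T : Type*} [Semigroup T] {n : ℕ} (v : Fin (n + 2) → T) :
    Fin.tail (Fin.contractNth 0 (· * ·) v) = Fin.tail (Fin.tail v) := by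
  funext k
  simp [Fin.tail, Fin.contractNth]

theorem tail_contractNth_succ {T : Type*} [Semigroup T] {n : ℕ} (j : Fin (n + 1))
    (v : Fin (n + 2) → T) :
    Fin.tail (Fin.contractNth j.succ (· * ·) v) = Fin.contractNth j (· * ·) (Fin.tail v) := by
  funext k
  simp [Fin.tail, Fin.contractNth]

theorem contractNth_contractNth {T : Type*} [Semigroup T] {n : ℕ} (i j : Fin (n + 1))
    (hij : i ≤ j) (v : Fin (n + 2) → T) :
    Fin.contractNth i (· * ·) (Fin.contractNth j.succ (· * ·) v) =
      Fin.contractNth j (· * ·) (Fin.contractNth i.castSucc (· * ·) v) := by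
  funext k
  have : (i : ℕ) ≤ j := hij
  simp only [Fin.contractNth, Fin.val_castSucc, Fin.val_succ]
  split_ifs <;> first | rfl | (exfalso; lia) | exact mul_assoc _ _ _ |
    exact (mul_assoc _ _ _).symm

/-! ### The complex of a semigroup -/

section Chains

variable (T : Type*) [Semigroup T] (A : Type*) [AddCommGroup A] [RightModule T A]

/-- `n`-chains: finite linear combinations of `n`-tuples of elements of `T` with coefficients
in `A`. For `n = 0` there is exactly one tuple `[]`, so that the `0`-chains are a copy of `A`. -/
abbrev Chains (n : ℕ) : Type _ := (Fin n → T) →₀ A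

/-- The boundary homomorphism
`δ(a[t₁, …, tₙ₊₁]) = at₁[t₂, …, tₙ₊₁] + ∑ᵢ (-1)ⁱ a[t₁, …, tᵢtᵢ₊₁, …, tₙ₊₁]
  + (-1)ⁿ⁺¹ a[t₁, …, tₙ]`.
The last summand is the one for the last index of the sum, as `Fin.contractNth` at the last index
omits the last entry. -/
noncomputable def boundary (n : ℕ) : Chains T A (n + 1) →+ Chains T A n :=
  Finsupp.liftAddHom fun v : Fin (n + 1) → T =>
    (Finsupp.singleAddHom (Fin.tail v) : A →+ Chains T A n).comp (RightModule.actHom A (v 0)) +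
      ∑ j : Fin (n + 1), (-1 : ℤ) ^ ((j : ℕ) + 1) •
        (Finsupp.singleAddHom (Fin.contractNth j (· * ·) v) : A →+ Chains T A n)

theorem boundary_single (n : ℕ) (v : Fin (n + 1) → T) (a : A) :
    boundary T A n (Finsupp.single v a) =
      Finsupp.single (Fin.tail v) (RightModule.act a (v 0)) +
        ∑ j : Fin (n + 1), (-1 : ℤ) ^ ((j : ℕ) + 1) •
          Finsupp.single (Fin.contractNth j (· * ·) v) a := by
  refine (Finsupp.liftAddHom_apply_single _ v a).trans ?_
  simp [RightModule.actHom]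

/-- The individual faces of a chain. -/
noncomputable def chainFace (n : ℕ) (i : Fin (n + 2)) : Chains T A (n + 1) →+ Chains T A n :=
  Finsupp.liftAddHom fun v =>
    Fin.cases ((Finsupp.singleAddHom (Fin.tail v) : A →+ Chains T A n).comp (RightModule.actHom A (v 0)))
      (fun j => (Finsupp.singleAddHom (Fin.contractNth j (· * ·) v) : A →+ Chains T A n)) i

theorem chainFace_zero_single (n : ℕ) (v : Fin (n + 1) → T) (a : A) :
    chainFace T A n 0 (Finsupp.single v a) =
      Finsupp.single (Fin.tail v) (RightModule.act a (v 0)) := by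
  refine (Finsupp.liftAddHom_apply_single _ v a).trans ?_
  simp [RightModule.actHom]

theorem chainFace_succ_single (n : ℕ) (j : Fin (n + 1)) (v : Fin (n + 1) → T) (a : A) :
    chainFace T A n j.succ (Finsupp.single v a) =
      Finsupp.single (Fin.contractNth j (· * ·) v) a := by
  simp [chainFace]

theorem boundary_eq_sum (n : ℕ) (x : Chains T A (n + 1)) :
    boundary T A n x = ∑ i : Fin (n + 2), (-1 : ℤ) ^ (i : ℕ) • chainFace T A n i x := by
  induction x using Finsupp.induction_linear with
  | zero => simp
  | add f g hf hg => simp only [map_add, hf, hg, smul_add, Finset.sum_add_distrib]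
  | single v a =>
    rw [boundary_single, Fin.sum_univ_succ (n := n + 1), chainFace_zero_single]
    simp only [chainFace_succ_single, Fin.val_zero, pow_zero, one_smul, Fin.val_succ]

theorem chainFace_chainFace (n : ℕ) (i j : Fin (n + 2)) (hij : i ≤ j)
    (x : Chains T A (n + 2)) :
    chainFace T A n i (chainFace T A (n + 1) j.succ x) =
      chainFace T A n j (chainFace T A (n + 1) i.castSucc x) := by
  induction x using Finsupp.induction_linear with
  | zero => simp
  | add f g hf hg => simp only [map_add, hf, hg]
  | single v a =>
    rw [chainFace_succ_single]
    induction i using Fin.cases with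
    | zero =>
      rw [Fin.castSucc_zero, chainFace_zero_single, chainFace_zero_single]
      induction j using Fin.cases with
      | zero =>
        rw [chainFace_zero_single, tail_contractNth_zero, RightModule.act_mul]
        simp [Fin.contractNth, Fin.tail]
      | succ j =>
        rw [chainFace_succ_single, tail_contractNth_succ]
        simp [Fin.contractNth]
    | succ i =>
      induction j using Fin.cases with
      | zero => simp at hij
      | succ j =>
        rw [← Fin.succ_castSucc, chainFace_succ_single, chainFace_succ_single,
          chainFace_succ_single, contractNth_contractNth i j (by simpa using hij)]

theorem boundary_boundary (n : ℕ) (x : Chains T A (n + 2)) :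
    boundary T A n (boundary T A (n + 1) x) = 0 := by
  simp only [boundary_eq_sum]
  exact sum_faces_sq n _ _ (chainFace_chainFace T A n) x

/-- The complex `C_*(T, A)` whose homology groups are the homology groups `H_n(T, A)` of the
semigroup `T` with coefficients in the right module `A`. -/
noncomputable def chainComplex : ChainComplex AddCommGrpCat ℕ :=
  ChainComplex.of (fun n => AddCommGrpCat.of (Chains T A n))
    (fun n => AddCommGrpCat.ofHom (boundary T A n)) fun n => by
      refine AddCommGrpCat.hom_ext (AddMonoidHom.ext fun x => ?_)
      exact boundary_boundary T A n x

theorem chainComplex_d (n : ℕ) :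
    (chainComplex T A).d (n + 1) n = AddCommGrpCat.ofHom (boundary T A n) :=
  ChainComplex.of_d (fun n => AddCommGrpCat.of (Chains T A n))
    (fun n => AddCommGrpCat.ofHom (boundary T A n)) n

end Chains

/-! ### The complex of 0-chains -/

/-- The product `v₁v₂⋯vₙ` is nonzero. (The product is taken in `S` with an identity adjoined, so
that the condition holds for the empty tuple.) -/
def ProdNeZero {S : Type*} [SemigroupWithZero S] {n : ℕ} (v : Fin n → S) : Prop :=
  (List.ofFn fun i => (v i : WithOne S)).prod ≠ ((0 : S) : WithOne S)

section ProdNeZero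

variable {S : Type*} [SemigroupWithZero S]

theorem withOne_zero_mul (m : WithOne S) : ((0 : S) : WithOne S) * m = ((0 : S) : WithOne S) := by
  cases m with
  | one => rw [mul_one]
  | coe a => rw [← WithOne.coe_mul, zero_mul]

theorem withOne_mul_zero (m : WithOne S) : m * ((0 : S) : WithOne S) = ((0 : S) : WithOne S) := by
  cases m with
  | one => rw [one_mul]
  | coe a => rw [← WithOne.coe_mul, mul_zero]

theorem ProdNeZero.tail {n : ℕ} {v : Fin (n + 1) → S} (h : ProdNeZero v) :
    ProdNeZero (Fin.tail v) := by
  intro h0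
  apply h
  rw [List.ofFn_succ, List.prod_cons]
  exact (congrArg _ h0).trans (withOne_mul_zero _)

theorem ProdNeZero.head {n : ℕ} {v : Fin (n + 1) → S} (h : ProdNeZero v) : v 0 ≠ 0 := by
  intro h0
  apply h
  rw [List.ofFn_succ, List.prod_cons, h0, withOne_zero_mul]

theorem ProdNeZero.apply_ne_zero {n : ℕ} {v : Fin n → S} (h : ProdNeZero v) (i : Fin n) :
    v i ≠ 0 := by
  induction n with
  | zero => exact i.elim0
  | succ n ih =>
    induction i using Fin.cases with
    | zero => exact h.head
    | succ i => exact ih h.tail i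

theorem exists_prod_contractNth {n : ℕ} (j : Fin (n + 1)) (v : Fin (n + 1) → S) :
    ∃ m : WithOne S, (List.ofFn fun i => (v i : WithOne S)).prod =
      (List.ofFn fun i => ((Fin.contractNth j (· * ·) v i : S) : WithOne S)).prod * m := by
  induction n with
  | zero => exact ⟨v 0, by simp⟩
  | succ n ih =>
    induction j using Fin.cases with
    | zero =>
      refine ⟨1, ?_⟩
      rw [List.ofFn_succ, List.ofFn_succ, List.prod_cons, List.prod_cons, ← mul_assoc, mul_one,
        List.ofFn_succ, List.prod_cons]
      simp [Fin.contractNth]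
    | succ j =>
      obtain ⟨m, hm⟩ := ih j (Fin.tail v)
      refine ⟨m, ?_⟩
      rw [List.ofFn_succ, List.prod_cons,
        List.ofFn_succ (f := fun i => ((Fin.contractNth j.succ (· * ·) v i : S) : WithOne S)),
        List.prod_cons, mul_assoc]
      rw [← tail_contractNth_succ] at hm
      simp only [Fin.tail] at hm
      rw [hm]
      simp [Fin.contractNth]

theorem ProdNeZero.contractNth {n : ℕ} {v : Fin (n + 1) → S} (h : ProdNeZero v)
    (j : Fin (n + 1)) : ProdNeZero (Fin.contractNth j (· * ·) v) := by
  intro h0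
  obtain ⟨m, hm⟩ := exists_prod_contractNth j v
  exact h (by rw [hm, h0, withOne_zero_mul])

end ProdNeZero

section ZeroChains

variable (S : Type*) [SemigroupWithZero S] (A : Type*) [AddCommGroup A] [ZeroModule S A]

/-- The set `D_n` of `n`-tuples of elements of `S` with nonzero product. -/
abbrev ZeroTuples (n : ℕ) : Type _ := {v : Fin n → S // ProdNeZero v}

/-- `n`-dimensional 0-chains: finite linear combinations of elements of `D_n` with coefficients
in `A`. For `n = 0` there is exactly one tuple `[]`, so that the 0-dimensional 0-chains are a
copy of `A`. -/
abbrev ZeroChains (n : ℕ) : Type _ := ZeroTuples S n →₀ A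

/-- The boundary homomorphism
`∂(a[s₁, …, sₙ₊₁]) = as₁[s₂, …, sₙ₊₁] + ∑ᵢ (-1)ⁱ a[s₁, …, sᵢsᵢ₊₁, …, sₙ₊₁]
  + (-1)ⁿ⁺¹ a[s₁, …, sₙ]`
of 0-chains. The last summand is the one for the last index of the sum. -/
noncomputable def zeroBoundary (n : ℕ) : ZeroChains S A (n + 1) →+ ZeroChains S A n :=
  Finsupp.liftAddHom fun v : ZeroTuples S (n + 1) =>
    (Finsupp.singleAddHom (⟨Fin.tail v.1, v.2.tail⟩ : ZeroTuples S n) : A →+ ZeroChains S A n).comp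
        (ZeroModule.actHom A ⟨v.1 0, v.2.head⟩) +
      ∑ j : Fin (n + 1), (-1 : ℤ) ^ ((j : ℕ) + 1) •
        (Finsupp.singleAddHom (⟨Fin.contractNth j (· * ·) v.1, v.2.contractNth j⟩ :
          ZeroTuples S n) : A →+ ZeroChains S A n)

theorem zeroBoundary_single (n : ℕ) (v : ZeroTuples S (n + 1)) (a : A) :
    zeroBoundary S A n (Finsupp.single v a) =
      Finsupp.single (⟨Fin.tail v.1, v.2.tail⟩ : ZeroTuples S n)
          (ZeroModule.act a ⟨v.1 0, v.2.head⟩) +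
        ∑ j : Fin (n + 1), (-1 : ℤ) ^ ((j : ℕ) + 1) •
          Finsupp.single
            (⟨Fin.contractNth j (· * ·) v.1, v.2.contractNth j⟩ : ZeroTuples S n) a := by
  refine (Finsupp.liftAddHom_apply_single _ v a).trans ?_
  simp [ZeroModule.actHom]

/-- The individual faces of a 0-chain. -/
noncomputable def zeroFace (n : ℕ) (i : Fin (n + 2)) :
    ZeroChains S A (n + 1) →+ ZeroChains S A n :=
  Finsupp.liftAddHom fun v =>
    Fin.cases ((Finsupp.singleAddHom (⟨Fin.tail v.1, v.2.tail⟩ : ZeroTuples S n) : A →+ ZeroChains S A n).comp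
        (ZeroModule.actHom A ⟨v.1 0, v.2.head⟩))
      (fun j => (Finsupp.singleAddHom
        (⟨Fin.contractNth j (· * ·) v.1, v.2.contractNth j⟩ : ZeroTuples S n) :
          A →+ ZeroChains S A n)) i

theorem zeroFace_zero_single (n : ℕ) (v : ZeroTuples S (n + 1)) (a : A) :
    zeroFace S A n 0 (Finsupp.single v a) =
      Finsupp.single ⟨Fin.tail v.1, v.2.tail⟩ (ZeroModule.act a ⟨v.1 0, v.2.head⟩) := by
  refine (Finsupp.liftAddHom_apply_single _ v a).trans ?_
  simp [ZeroModule.actHom]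

theorem zeroFace_succ_single (n : ℕ) (j : Fin (n + 1)) (v : ZeroTuples S (n + 1)) (a : A) :
    zeroFace S A n j.succ (Finsupp.single v a) =
      Finsupp.single ⟨Fin.contractNth j (· * ·) v.1, v.2.contractNth j⟩ a := by
  simp [zeroFace]

theorem zeroBoundary_eq_sum (n : ℕ) (x : ZeroChains S A (n + 1)) :
    zeroBoundary S A n x = ∑ i : Fin (n + 2), (-1 : ℤ) ^ (i : ℕ) • zeroFace S A n i x := by
  induction x using Finsupp.induction_linear with
  | zero => simp
  | add f g hf hg => simp only [map_add, hf, hg, smul_add, Finset.sum_add_distrib]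
  | single v a =>
    rw [zeroBoundary_single, Fin.sum_univ_succ (n := n + 1), zeroFace_zero_single]
    simp only [zeroFace_succ_single, Fin.val_zero, pow_zero, one_smul, Fin.val_succ]

theorem zeroFace_zeroFace (n : ℕ) (i j : Fin (n + 2)) (hij : i ≤ j)
    (x : ZeroChains S A (n + 2)) :
    zeroFace S A n i (zeroFace S A (n + 1) j.succ x) =
      zeroFace S A n j (zeroFace S A (n + 1) i.castSucc x) := by
  induction x using Finsupp.induction_linear with
  | zero => simp
  | add f g hf hg => simp only [map_add, hf, hg]
  | single v a =>
    rw [zeroFace_succ_single]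
    induction i using Fin.cases with
    | zero =>
      rw [Fin.castSucc_zero, zeroFace_zero_single, zeroFace_zero_single]
      induction j using Fin.cases with
      | zero =>
        have h01 : v.1 0 * v.1 1 ≠ 0 := by
          simpa [Fin.contractNth] using (v.2.contractNth 0).head
        rw [zeroFace_zero_single]
        have h1 : (⟨Fin.tail (Fin.contractNth 0 (· * ·) v.1), (v.2.contractNth 0).tail⟩ :
            ZeroTuples S n) = ⟨Fin.tail (Fin.tail v.1), v.2.tail.tail⟩ :=
          Subtype.ext (tail_contractNth_zero v.1)
        have h2 := ZeroModule.act_mul a ⟨v.1 0, v.2.head⟩ ⟨v.1 1, v.2.tail.head⟩ h01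
        exact (congrArg (fun w => Finsupp.single w _) h1).trans
          (congrArg (Finsupp.single _) h2.symm)
      | succ j =>
        rw [zeroFace_succ_single]
        congr 1
        exact Subtype.ext (tail_contractNth_succ j v.1)
    | succ i =>
      induction j using Fin.cases with
      | zero => simp at hij
      | succ j =>
        rw [← Fin.succ_castSucc, zeroFace_succ_single, zeroFace_succ_single,
          zeroFace_succ_single]
        congr 1
        exact Subtype.ext (contractNth_contractNth i j (by simpa using hij) v.1)

theorem zeroBoundary_zeroBoundary (n : ℕ) (x : ZeroChains S A (n + 2)) :
    zeroBoundary S A n (zeroBoundary S A (n + 1) x) = 0 := by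
  simp only [zeroBoundary_eq_sum]
  exact sum_faces_sq n _ _ (zeroFace_zeroFace S A n) x

/-- The complex `C^0_*(S, A)` whose homology groups are the 0-homology groups `H^0_n(S, A)`. -/
noncomputable def zeroChainComplex : ChainComplex AddCommGrpCat ℕ :=
  ChainComplex.of (fun n => AddCommGrpCat.of (ZeroChains S A n))
    (fun n => AddCommGrpCat.ofHom (zeroBoundary S A n)) fun n => by
      refine AddCommGrpCat.hom_ext (AddMonoidHom.ext fun x => ?_)
      exact zeroBoundary_zeroBoundary S A n x

theorem zeroChainComplex_d (n : ℕ) :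
    (zeroChainComplex S A).d (n + 1) n = AddCommGrpCat.ofHom (zeroBoundary S A n) :=
  ChainComplex.of_d (fun n => AddCommGrpCat.of (ZeroChains S A n))
    (fun n => AddCommGrpCat.ofHom (zeroBoundary S A n)) n

end ZeroChains

/-! ### The chain map -/

section ChainMap

variable (S : Type*) [SemigroupWithZero S] (A : Type*) [AddCommGroup A]

/-- `[s₁, …, sₙ] ↦ [⟨s₁⟩, …, ⟨sₙ⟩]`. -/
def ZeroTuples.toReflector {S : Type*} [SemigroupWithZero S] {n : ℕ} (v : ZeroTuples S n) :
    Fin n → Reflector S :=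
  fun i => Reflector.of ⟨v.1 i, v.2.apply_ne_zero i⟩

/-- `ε_n(a[s₁, …, sₙ]) = a[⟨s₁⟩, …, ⟨sₙ⟩]`. -/
noncomputable def epsilonHom (n : ℕ) : ZeroChains S A n →+ Chains (Reflector S) A n :=
  Finsupp.liftAddHom fun v => Finsupp.singleAddHom v.toReflector

theorem epsilonHom_single (n : ℕ) (v : ZeroTuples S n) (a : A) :
    epsilonHom S A n (Finsupp.single v a) = Finsupp.single v.toReflector a := by
  simp [epsilonHom]

theorem contractNth_toReflector {n : ℕ} (j : Fin (n + 1)) (v : ZeroTuples S (n + 1)) :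
    Fin.contractNth j (· * ·) v.toReflector =
      ZeroTuples.toReflector ⟨Fin.contractNth j (· * ·) v.1, v.2.contractNth j⟩ := by
  funext k
  have hk := (v.2.contractNth j).apply_ne_zero k
  simp only [Fin.contractNth, ZeroTuples.toReflector] at hk ⊢
  split_ifs with h1 h2
  · rfl
  · rw [if_neg h1, if_pos h2] at hk
    exact Reflector.of_mul_of _ _ hk
  · rfl

theorem boundary_epsilonHom [ZeroModule S A] (n : ℕ) (x : ZeroChains S A (n + 1)) :
    boundary (Reflector S) A n (epsilonHom S A (n + 1) x) =
      epsilonHom S A n (zeroBoundary S A n x) := by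
  induction x using Finsupp.induction_linear with
  | zero => simp
  | add f g hf hg => simp only [map_add, hf, hg]
  | single v a =>
    rw [epsilonHom_single, boundary_single, zeroBoundary_single]
    simp only [map_add, map_sum, map_zsmul, epsilonHom_single, contractNth_toReflector]
    rw [← Reflector.act_of]
    rfl

/-- The chain map `ε : C^0_*(S, A) ⟶ C_*(S̄, A)`. -/
noncomputable def epsilon [ZeroModule S A] : zeroChainComplex S A ⟶ chainComplex (Reflector S) A :=
  ChainComplex.ofHom
    (X := zeroChainComplex S A) (Y := chainComplex (Reflector S) A)
    (fun n => AddCommGrpCat.ofHom (epsilonHom S A n)) fun n => by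
    rw [chainComplex_d, zeroChainComplex_d]
    refine AddCommGrpCat.hom_ext (AddMonoidHom.ext fun x => ?_)
    exact boundary_epsilonHom S A n x

end ChainMap

/-! ### Normal forms in the 0-reflector -/

section NormalForm

variable {S : Type*} [SemigroupWithZero S]

/-! The map `epsilon` embeds the 0-chains into the bar complex of `Reflector S`, and a discrete
Morse argument shows that the quotient complex is acyclic. Categoricity at zero enters through one
fact: if `ab ≠ 0`, then `abc ≠ 0` exactly when `bc ≠ 0`. So whether neighbouring letters contract is
not affected by earlier contractions, and every element of the reflector has a normal form.

Read a tuple from the left as long as its entries are single letters with nonzero consecutive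
products. If the whole tuple is read, it is critical, and the critical tuples are exactly the images
of the 0-tuples. Otherwise let `a` be the first letter of the entry `x` where reading stops. If the
preceding letter `s` has `sa = 0`, merge `s` and `x`; if not, `x` is longer than one letter, and `a`
is split off. The two moves are mutually inverse and pair a tuple `u` with one of its faces `r`
(`CellMatch`, `chained_or_cellMatch`).

Leave aside the face that removes the first entry and lets it act on the coefficient. Then every
face of `u` other than `r` is critical or the larger member of another pair
(`CellMatch.contract_of_ne`). The exceptional face has smaller total length, while `u` and `r` have
the same. Induction on this weight moves every chain, modulo boundaries, into 0-chains plus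
combinations of larger members (`exists_sub_boundary_mem_reducedChains`). Looking at a term of
maximal weight shows that a combination of larger members whose boundary is a 0-chain vanishes
(`eq_zero_of_boundary_mem_range`). Together these give `exists_sub_boundary_mem_range`, from which
`isIso_homologyMap_of_chains` concludes. -/

theorem Reflector.induction_on {P : Reflector S → Prop} (x : Reflector S)
    (of : ∀ s, P (Reflector.of s)) (of_mul : ∀ s x, P x → P (Reflector.of s * x)) : P x := by
  induction x using Con.induction_on with
  | _ w =>
    induction w using FreeSemigroup.recOnMul with
    | ih1 s => exact of s
    | ih2 s w hs hw => exact of_mul s _ hw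

open Classical in
/-- Left multiplication of a word by a letter, contracting the first product if it is nonzero. -/
noncomputable def consReduce (s : {s : S // s ≠ 0}) :
    List {s : S // s ≠ 0} → List {s : S // s ≠ 0}
  | [] => [s]
  | a :: l => if h : s.1 * a.1 ≠ 0 then ⟨s.1 * a.1, h⟩ :: l else s :: a :: l

theorem consReduce_nil (s : {s : S // s ≠ 0}) : consReduce s [] = [s] := rfl

theorem consReduce_cons_of_ne {s a : {s : S // s ≠ 0}} (h : s.1 * a.1 ≠ 0)
    (l : List {s : S // s ≠ 0}) : consReduce s (a :: l) = ⟨s.1 * a.1, h⟩ :: l :=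
  dif_pos h

theorem consReduce_cons_of_eq {s a : {s : S // s ≠ 0}} (h : s.1 * a.1 = 0)
    (l : List {s : S // s ≠ 0}) : consReduce s (a :: l) = s :: a :: l :=
  dif_neg (not_not.2 h)

theorem CategoricalAtZero.mul_mul_ne_zero_iff (hS : CategoricalAtZero S) {a b : S}
    (h : a * b ≠ 0) (c : S) : a * b * c ≠ 0 ↔ b * c ≠ 0 := by
  refine ⟨fun h1 h2 => h1 (by rw [mul_assoc, h2, mul_zero]), fun h1 h2 => ?_⟩
  exact (hS a b c h2).elim h h1

theorem CategoricalAtZero.mul_mul_ne_zero_iff' (hS : CategoricalAtZero S) {b c : S}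
    (h : b * c ≠ 0) (a : S) : a * (b * c) ≠ 0 ↔ a * b ≠ 0 := by
  refine ⟨fun h1 h2 => h1 (by rw [← mul_assoc, h2, zero_mul]), fun h1 h2 => ?_⟩
  exact (hS a b c (by rw [mul_assoc, h2])).elim h1 h

/-- This is what makes letters act on words compatibly with the defining relations. Since `st ≠ 0`,
the letters `st` and `t` contract with the same letters `a`, and if neither contracts with `a`, then
`s` still contracts with `t`. -/
theorem consReduce_mul (hS : CategoricalAtZero S) (s t : {s : S // s ≠ 0}) (h : s.1 * t.1 ≠ 0)
    (l : List {s : S // s ≠ 0}) :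
    consReduce ⟨s.1 * t.1, h⟩ l = consReduce s (consReduce t l) := by
  cases l with
  | nil => rw [consReduce_nil, consReduce_nil, consReduce_cons_of_ne h]
  | cons a l =>
    by_cases hta : t.1 * a.1 = 0
    · rw [consReduce_cons_of_eq hta, consReduce_cons_of_ne h, consReduce_cons_of_eq]
      change s.1 * t.1 * a.1 = 0
      rw [mul_assoc, hta, mul_zero]
    · have h1 : s.1 * t.1 * a.1 ≠ 0 := (hS.mul_mul_ne_zero_iff h a.1).2 hta
      have h2 : s.1 * (t.1 * a.1) ≠ 0 := by rwa [← mul_assoc]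
      rw [consReduce_cons_of_ne hta, consReduce_cons_of_ne (s := s) h2,
        consReduce_cons_of_ne (s := ⟨s.1 * t.1, h⟩) h1]
      simp only [mul_assoc]

variable (hS : CategoricalAtZero S)

/-- Left multiplication by letters, extended to an action of the 0-reflector on words. -/
noncomputable def Reflector.wordAction :
    Reflector S →ₙ* Function.End (List {s : S // s ≠ 0}) :=
  Reflector.lift (T := Function.End (List {s : S // s ≠ 0})) (fun s => consReduce s)
    fun s t h => funext fun l => consReduce_mul hS s t h l

/-- The normal form of an element of the 0-reflector: the word `s₁⋯sₖ` with `sᵢsᵢ₊₁ = 0`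
representing it. -/
noncomputable def Reflector.normalForm (x : Reflector S) : List {s : S // s ≠ 0} :=
  Reflector.wordAction hS x []

theorem Reflector.wordAction_of (s : {s : S // s ≠ 0}) (l : List {s : S // s ≠ 0}) :
    Reflector.wordAction hS (Reflector.of s) l = consReduce s l :=
  congrFun (Reflector.lift_of (T := Function.End (List {s : S // s ≠ 0}))
    (fun s => consReduce s) (fun s t h => funext fun l => consReduce_mul hS s t h l) s) l

theorem Reflector.normalForm_of (s : {s : S // s ≠ 0}) :
    (Reflector.of s).normalForm hS = [s] :=
  Reflector.wordAction_of hS s []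

theorem Reflector.normalForm_of_mul (s : {s : S // s ≠ 0}) (x : Reflector S) :
    (Reflector.of s * x).normalForm hS = consReduce s (x.normalForm hS) := by
  rw [Reflector.normalForm, map_mul]
  exact Reflector.wordAction_of hS s _

theorem Reflector.prod_consReduce (s : {s : S // s ≠ 0}) (l : List {s : S // s ≠ 0}) :
    ((consReduce s l).map fun a => (Reflector.of a : WithOne (Reflector S))).prod =
      Reflector.of s * (l.map fun a => (Reflector.of a : WithOne (Reflector S))).prod := by
  cases l with
  | nil => simp [consReduce_nil]
  | cons a l =>
    by_cases h : s.1 * a.1 = 0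
    · rw [consReduce_cons_of_eq h]
      simp
    · rw [consReduce_cons_of_ne h, List.map_cons, List.map_cons, List.prod_cons, List.prod_cons,
        ← Reflector.of_mul_of s a h, WithOne.coe_mul, mul_assoc]

theorem Reflector.prod_normalForm (x : Reflector S) :
    ((x.normalForm hS).map fun a => (Reflector.of a : WithOne (Reflector S))).prod = x := by
  induction x using Reflector.induction_on with
  | of s => simp [Reflector.normalForm_of]
  | of_mul s x ih => rw [Reflector.normalForm_of_mul, Reflector.prod_consReduce, ih,
      WithOne.coe_mul]

theorem Reflector.normalForm_injective :
    Function.Injective (Reflector.normalForm hS : Reflector S → _) := fun x y h =>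
  WithOne.coe_injective (by rw [← Reflector.prod_normalForm hS x, h, Reflector.prod_normalForm])

theorem Reflector.normalForm_ne_nil (x : Reflector S) : x.normalForm hS ≠ [] := by
  intro h
  have := Reflector.prod_normalForm hS x
  rw [h] at this
  exact WithOne.one_ne_coe this

theorem Reflector.of_injective (hS : CategoricalAtZero S) :
    Function.Injective (Reflector.of : {s : S // s ≠ 0} → Reflector S) := fun s t h => by
  simpa [Reflector.normalForm_of] using congrArg (Reflector.normalForm hS) h

/-! ### Reduced products -/

/-- The letter `s` cannot be contracted with the first letter of the normal form of `x`. -/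
def Reflector.Reduced (s : {s : S // s ≠ 0}) (x : Reflector S) : Prop :=
  (Reflector.of s * x).normalForm hS = s :: x.normalForm hS

/-- A contraction would leave a word too short to be `s` followed by the old one. -/
theorem Reflector.reduced_iff {s b : {s : S // s ≠ 0}} {x : Reflector S}
    {l : List {s : S // s ≠ 0}} (h : x.normalForm hS = b :: l) :
    Reflector.Reduced hS s x ↔ s.1 * b.1 = 0 := by
  rw [Reflector.Reduced, Reflector.normalForm_of_mul, h]
  refine ⟨fun h1 => by_contra fun h2 => ?_, fun h2 => consReduce_cons_of_eq h2 l⟩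
  rw [consReduce_cons_of_ne h2] at h1
  simpa using congrArg List.length h1

theorem Reflector.reduced_of_iff {s b : {s : S // s ≠ 0}} :
    Reflector.Reduced hS s (Reflector.of b) ↔ s.1 * b.1 = 0 :=
  Reflector.reduced_iff hS (Reflector.normalForm_of hS b)

/-- The normal form of `⟨b⟩x` starts with `b` or with some nonzero `bc`, and by categoricity `s`
annihilates `bc` exactly when it annihilates `b`. No reducedness of `⟨b⟩x` is needed. -/
theorem Reflector.reduced_of_mul_iff {s b : {s : S // s ≠ 0}} {x : Reflector S} :
    Reflector.Reduced hS s (Reflector.of b * x) ↔ s.1 * b.1 = 0 := by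
  obtain ⟨c, l, hx⟩ := List.exists_cons_of_ne_nil (Reflector.normalForm_ne_nil hS x)
  by_cases h : b.1 * c.1 = 0
  · exact Reflector.reduced_iff hS (l := c :: l)
      (by rw [Reflector.normalForm_of_mul, hx, consReduce_cons_of_eq h])
  · rw [Reflector.reduced_iff hS (l := l) (b := ⟨b.1 * c.1, h⟩)
      (by rw [Reflector.normalForm_of_mul, hx, consReduce_cons_of_ne h])]
    exact not_iff_not.1 (hS.mul_mul_ne_zero_iff' h s.1)

theorem Reflector.Reduced.mul_right {s : {s : S // s ≠ 0}} {x : Reflector S}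
    (h : Reflector.Reduced hS s x) (y : Reflector S) : Reflector.Reduced hS s (x * y) := by
  induction x using Reflector.induction_on with
  | of b => exact (Reflector.reduced_of_mul_iff hS).2 ((Reflector.reduced_of_iff hS).1 h)
  | of_mul b x _ =>
    rw [mul_assoc]
    exact (Reflector.reduced_of_mul_iff hS).2 ((Reflector.reduced_of_mul_iff hS).1 h)

theorem Reflector.reduced_mul_iff {s t : {s : S // s ≠ 0}} (h : s.1 * t.1 ≠ 0)
    {x : Reflector S} :
    Reflector.Reduced hS ⟨s.1 * t.1, h⟩ x ↔ Reflector.Reduced hS t x := by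
  obtain ⟨c, l, hx⟩ := List.exists_cons_of_ne_nil (Reflector.normalForm_ne_nil hS x)
  rw [Reflector.reduced_iff hS hx, Reflector.reduced_iff hS hx]
  exact not_iff_not.1 (hS.mul_mul_ne_zero_iff h c.1)

/-- In the matching, the second form marks the entries from which a letter can be split off. -/
theorem Reflector.eq_of_or_eq_of_mul (x : Reflector S) :
    (∃ a, x = Reflector.of a) ∨ ∃ a y, Reflector.Reduced hS a y ∧ x = Reflector.of a * y := by
  induction x using Reflector.induction_on with
  | of s => exact Or.inl ⟨s, rfl⟩
  | of_mul s x ih =>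
    obtain ⟨b, rfl⟩ | ⟨b, y, hy, rfl⟩ := ih
    · by_cases h : s.1 * b.1 = 0
      · exact Or.inr ⟨s, _, (Reflector.reduced_of_iff hS).2 h, rfl⟩
      · exact Or.inl ⟨_, Reflector.of_mul_of s b h⟩
    · by_cases h : s.1 * b.1 = 0
      · exact Or.inr ⟨s, _, (Reflector.reduced_of_mul_iff hS).2 h, rfl⟩
      · refine Or.inr ⟨_, y, (Reflector.reduced_mul_iff hS h).2 hy, ?_⟩
        rw [← mul_assoc, Reflector.of_mul_of s b h]

theorem Reflector.Reduced.of_mul_ne_of {s b : {s : S // s ≠ 0}} {x : Reflector S}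
    (h : Reflector.Reduced hS s x) : Reflector.of s * x ≠ Reflector.of b := by
  intro h1
  have h2 := congrArg List.length (h.symm.trans (congrArg (Reflector.normalForm hS) h1))
  rw [Reflector.normalForm_of, List.length_cons, List.length_singleton] at h2
  exact Reflector.normalForm_ne_nil hS x (List.length_eq_zero_iff.1 (by lia))

theorem Reflector.Reduced.of_mul_inj {s t : {s : S // s ≠ 0}} {x y : Reflector S}
    (hx : Reflector.Reduced hS s x) (hy : Reflector.Reduced hS t y)
    (h : Reflector.of s * x = Reflector.of t * y) : s = t ∧ x = y := by
  have h1 := hx.symm.trans ((congrArg (Reflector.normalForm hS) h).trans hy)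
  rw [List.cons.injEq] at h1
  exact ⟨h1.1, Reflector.normalForm_injective hS h1.2⟩

/-- The length of the normal form. -/
noncomputable def Reflector.length (x : Reflector S) : ℕ := (x.normalForm hS).length

theorem Reflector.length_pos (x : Reflector S) : 0 < x.length hS :=
  List.length_pos_iff.2 (Reflector.normalForm_ne_nil hS x)

theorem Reflector.length_of (s : {s : S // s ≠ 0}) : (Reflector.of s).length hS = 1 := by
  rw [Reflector.length, Reflector.normalForm_of, List.length_singleton]

theorem Reflector.Reduced.length {s : {s : S // s ≠ 0}} {x : Reflector S}
    (h : Reflector.Reduced hS s x) : (Reflector.of s * x).length hS = x.length hS + 1 := by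
  rw [Reflector.length, h, List.length_cons, Reflector.length]

end NormalForm

/-! ### Matching of cells -/

section Matching

/-- Replaces the entries number `j` and `j + 1` by their product; omits the last entry if it is
number `j`. -/
def List.contract {T : Type*} [Mul T] : ℕ → List T → List T
  | _, [] => []
  | 0, [_] => []
  | 0, x :: y :: l => (x * y) :: l
  | j + 1, x :: l => x :: List.contract j l

theorem List.ofFn_contractNth {T : Type*} [Semigroup T] {n : ℕ} (j : Fin (n + 1))
    (v : Fin (n + 1) → T) :
    List.ofFn (Fin.contractNth j (· * ·) v) = List.contract j (List.ofFn v) := by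
  induction n with
  | zero =>
    obtain rfl : j = 0 := Fin.ext (by lia)
    simp [List.contract]
  | succ n ih =>
    induction j using Fin.cases with
    | zero =>
      rw [List.ofFn_succ, List.ofFn_succ (f := v), List.ofFn_succ (n := n)]
      simp [Fin.contractNth, List.contract]
    | succ j =>
      rw [List.ofFn_succ, List.ofFn_succ (f := v), Fin.val_succ, List.contract]
      have h := ih j (Fin.tail v)
      rw [← tail_contractNth_succ] at h
      exact congrArg₂ List.cons (by simp [Fin.contractNth]) h

variable {S : Type*} [SemigroupWithZero S]

/-- The letters `b` with `ab ≠ 0`. -/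
def Follows (a b : {s : S // s ≠ 0}) : Prop := a.1 * b.1 ≠ 0

/-- The tuples `[⟨s₁⟩, …, ⟨sₙ⟩]` with `sᵢsᵢ₊₁ ≠ 0` such that `s₁` satisfies `p`. -/
inductive Chained : ({s : S // s ≠ 0} → Prop) → List (Reflector S) → Prop
  | nil (p : {s : S // s ≠ 0} → Prop) : Chained p []
  | cons (p : {s : S // s ≠ 0} → Prop) (a : {s : S // s ≠ 0}) (l : List (Reflector S)) (ha : p a)
      (hl : Chained (Follows a) l) : Chained p (Reflector.of a :: l)

variable (hS : CategoricalAtZero S)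

/-- The discrete Morse matching: `CellMatch hS p u i r` means that
`u = [⟨s₁⟩, …, ⟨sᵢ⟩, ⟨a⟩, x, …]` and `r = [⟨s₁⟩, …, ⟨sᵢ⟩, ⟨a⟩x, …]` where `⟨a⟩x` is reduced and the
product of `s₁, …, sᵢ, a` is nonzero (and the first of these letters satisfies `p`). -/
inductive CellMatch :
    ({s : S // s ≠ 0} → Prop) → List (Reflector S) → ℕ → List (Reflector S) → Prop
  | here (p : {s : S // s ≠ 0} → Prop) (a : {s : S // s ≠ 0}) (x y : Reflector S)
      (l : List (Reflector S)) (ha : p a) (hx : Reflector.Reduced hS a x)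
      (hy : y = Reflector.of a * x) : CellMatch p (Reflector.of a :: x :: l) 0 (y :: l)
  | cons (p : {s : S // s ≠ 0} → Prop) (a : {s : S // s ≠ 0}) (u : List (Reflector S)) (i : ℕ)
      (r : List (Reflector S)) (ha : p a) (h : CellMatch (Follows a) u i r) :
      CellMatch p (Reflector.of a :: u) (i + 1) (Reflector.of a :: r)

/-- `p (ab) ↔ p a` whenever `ab ≠ 0`. -/
def LeftInvariant (p : {s : S // s ≠ 0} → Prop) : Prop :=
  ∀ (a b : {s : S // s ≠ 0}) (h : a.1 * b.1 ≠ 0), p ⟨a.1 * b.1, h⟩ ↔ p a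

theorem leftInvariant_follows (hS : CategoricalAtZero S) (a : {s : S // s ≠ 0}) :
    LeftInvariant (Follows a) := fun _ _ h =>
  hS.mul_mul_ne_zero_iff' h a.1

theorem follows_mul (hS : CategoricalAtZero S) {a b : {s : S // s ≠ 0}} (h : a.1 * b.1 ≠ 0) :
    Follows ⟨a.1 * b.1, h⟩ = Follows b :=
  funext fun c => propext (hS.mul_mul_ne_zero_iff h c.1)

theorem reduced_of_iff_not_follows {a b : {s : S // s ≠ 0}} :
    Reflector.Reduced hS a (Reflector.of b) ↔ ¬ Follows a b :=
  (Reflector.reduced_of_iff hS).trans not_not.symm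

theorem chained_or_cellMatch (p : {s : S // s ≠ 0} → Prop) (l : List (Reflector S)) :
    Chained p l ∨ (∃ u i, CellMatch hS p u i l) ∨ (∃ i r, CellMatch hS p l i r) ∨
      ∃ a x t, l = x :: t ∧ ¬ p a ∧ (x = Reflector.of a ∨ ∃ y, x = Reflector.of a * y) := by
  induction l generalizing p with
  | nil => exact Or.inl (Chained.nil p)
  | cons x l ih =>
    obtain ⟨a, rfl⟩ | ⟨a, y, hy, rfl⟩ := x.eq_of_or_eq_of_mul hS
    · by_cases ha : p a
      · obtain h | ⟨u, i, h⟩ | ⟨i, r, h⟩ | ⟨b, x, t, rfl, hb, h⟩ := ih (Follows a)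
        · exact Or.inl (Chained.cons p a l ha h)
        · exact Or.inr (Or.inl ⟨_, _, CellMatch.cons p a u i l ha h⟩)
        · exact Or.inr (Or.inr (Or.inl ⟨_, _, CellMatch.cons p a l i r ha h⟩))
        -- The fourth alternative for the tail says that its first letter does not follow `a`; then
        -- `a` forms a reduced product with the next entry and is merged with it.
        · refine Or.inr (Or.inr (Or.inl ⟨_, _, CellMatch.here p a x _ t ha ?_ rfl⟩))
          obtain rfl | ⟨y, rfl⟩ := h
          · exact (reduced_of_iff_not_follows hS).2 hb
          · exact (Reflector.reduced_of_mul_iff hS).2 (not_not.1 hb)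
      · exact Or.inr (Or.inr (Or.inr ⟨a, _, l, rfl, ha, Or.inl rfl⟩))
    · by_cases ha : p a
      · exact Or.inr (Or.inl ⟨_, _, CellMatch.here p a y _ l ha hy rfl⟩)
      · exact Or.inr (Or.inr (Or.inr ⟨a, _, l, rfl, ha, Or.inr ⟨y, rfl⟩⟩))

theorem chained_or_cellMatch_top (l : List (Reflector S)) :
    Chained (fun _ => True) l ∨ (∃ u i, CellMatch hS (fun _ => True) u i l) ∨
      ∃ i r, CellMatch hS (fun _ => True) l i r := by
  obtain h | h | h | ⟨a, x, t, -, h, -⟩ := chained_or_cellMatch hS (fun _ => True) l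
  · exact Or.inl h
  · exact Or.inr (Or.inl h)
  · exact Or.inr (Or.inr h)
  · exact absurd trivial h

/-! ### Faces and uniqueness of matched cells -/

variable {hS}

theorem CellMatch.contract_eq {p : {s : S // s ≠ 0} → Prop} {u r : List (Reflector S)} {i : ℕ}
    (h : CellMatch hS p u i r) : List.contract i u = r := by
  induction h with
  | here p a x y l ha hx hy => rw [List.contract, hy]
  | cons p a u i r ha h ih => rw [List.contract, ih]

theorem CellMatch.length_eq {p : {s : S // s ≠ 0} → Prop} {u r : List (Reflector S)} {i : ℕ}
    (h : CellMatch hS p u i r) : u.length = r.length + 1 := by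
  induction h with
  | here p a x y l ha hx hy => rfl
  | cons p a u i r ha h ih => rw [List.length_cons, List.length_cons, ih]

theorem CellMatch.lt_length {p : {s : S // s ≠ 0} → Prop} {u r : List (Reflector S)} {i : ℕ}
    (h : CellMatch hS p u i r) : i < r.length := by
  induction h with
  | here p a x y l ha hx hy => exact Nat.succ_pos _
  | cons p a u i r ha h ih => exact Nat.succ_lt_succ ih

/-- Lengths add up in the reduced product `⟨a⟩x`, so the matched face keeps the weight. -/
theorem CellMatch.sum_length_eq {p : {s : S // s ≠ 0} → Prop} {u r : List (Reflector S)} {i : ℕ}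
    (h : CellMatch hS p u i r) :
    (u.map (Reflector.length hS)).sum = (r.map (Reflector.length hS)).sum := by
  induction h with
  | here p a x y l ha hx hy =>
    simp only [List.map_cons, List.sum_cons, hy, hx.length, Reflector.length_of]
    ring
  | cons p a u i r ha h ih => rw [List.map_cons, List.sum_cons, ih, List.map_cons, List.sum_cons]

/-- Merging two letters of the prefix before or at the splitting point keeps the cell matched: `ab`
satisfies `p` because `a` does, and it is followed by the same letters, and reduced against the same
elements, as `b`. -/
theorem CellMatch.cons_mul {p : {s : S // s ≠ 0} → Prop} {u r : List (Reflector S)} {i : ℕ}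
    {a : {s : S // s ≠ 0}} (hp : LeftInvariant p) (ha : p a)
    (h : CellMatch hS (Follows a) u i r) :
    ∃ i' r', CellMatch hS p (List.contract 0 (Reflector.of a :: u)) i' r' := by
  cases h with
  | here _ b x y l hb hx hy =>
    rw [List.contract, Reflector.of_mul_of a b hb]
    exact ⟨_, _, CellMatch.here p _ x _ l ((hp a b hb).2 ha)
      ((Reflector.reduced_mul_iff hS hb).2 hx) rfl⟩
  | cons _ b u i r hb h =>
    rw [List.contract, Reflector.of_mul_of a b hb]
    exact ⟨_, _, CellMatch.cons p _ u i r ((hp a b hb).2 ha) (by rwa [follows_mul hS hb])⟩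

/-- A contraction to the left of position `i` multiplies two letters of the prefix. One just after
it replaces `x` by `xz`, which stays reduced against `a`, or drops a final `x` and leaves a critical
tuple. One further right does not touch the pattern. -/
theorem CellMatch.contract_of_ne {p : {s : S // s ≠ 0} → Prop} {u r : List (Reflector S)} {i : ℕ}
    (h : CellMatch hS p u i r) (hp : LeftInvariant p) (j : ℕ) (hj : j ≠ i) :
    Chained p (List.contract j u) ∨ ∃ i' r', CellMatch hS p (List.contract j u) i' r' := by
  induction h generalizing j with
  | here p a x y l ha hx hy =>
    obtain _ | _ | k := j
    · exact absurd rfl hj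
    · cases l with
      | nil => exact Or.inl (Chained.cons p a _ ha (Chained.nil _))
      | cons z l => exact Or.inr ⟨_, _, CellMatch.here p a _ _ l ha (hx.mul_right hS z) rfl⟩
    · rw [List.contract, List.contract]
      exact Or.inr ⟨_, _, CellMatch.here p a x _ _ ha hx rfl⟩
  | cons p a u i r ha h ih =>
    cases j with
    | zero => exact Or.inr (h.cons_mul hp ha)
    | succ k =>
      rw [List.contract]
      obtain h1 | ⟨i', r', h1⟩ := ih (leftInvariant_follows hS a) k (by lia)
      · exact Or.inl (Chained.cons p a _ ha h1)
      · exact Or.inr ⟨_, _, CellMatch.cons p a _ _ _ ha h1⟩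

theorem CellMatch.left_unique {p : {s : S // s ≠ 0} → Prop} {u u' r : List (Reflector S)}
    {i i' : ℕ} (h : CellMatch hS p u i r) (h' : CellMatch hS p u' i' r) : u = u' := by
  induction h generalizing u' i' with
  | here p a x y l ha hx hy =>
    cases h' with
    | here _ b z _ _ hb hz hy' =>
      obtain ⟨rfl, rfl⟩ := Reflector.Reduced.of_mul_inj hS hx hz (hy.symm.trans hy')
      rfl
    | cons _ b u i _ hb h => exact absurd hy.symm (hx.of_mul_ne_of hS)
  | cons p a u i r ha h ih =>
    -- A variable head lets case analysis unify the indices; the letter is recovered from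
    -- injectivity of `Reflector.of`.
    generalize hy : Reflector.of a = y at h'
    cases h' with
    | here _ b z _ _ hb hz hy' => exact absurd (hy'.symm.trans hy.symm) (hz.of_mul_ne_of hS)
    | cons _ b u' i' _ hb h' =>
      obtain rfl := Reflector.of_injective hS hy
      rw [ih h']

/-- This separates the two constructors: merging after `a` needs a reduced product, continuing past
`a` excludes one. -/
theorem CellMatch.head_follows {a : {s : S // s ≠ 0}} {x : Reflector S} {l r : List (Reflector S)}
    {i : ℕ} (h : CellMatch hS (Follows a) (x :: l) i r) : ¬ Reflector.Reduced hS a x := by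
  cases h with
  | here _ b _ _ _ hb _ _ => exact fun h => (reduced_of_iff_not_follows hS).1 h hb
  | cons _ b _ _ _ hb _ => exact fun h => (reduced_of_iff_not_follows hS).1 h hb

theorem CellMatch.head_follows' {a : {s : S // s ≠ 0}} {x : Reflector S}
    {l u : List (Reflector S)} {i : ℕ} (h : CellMatch hS (Follows a) u i (x :: l)) :
    ¬ Reflector.Reduced hS a x := by
  cases h with
  | here _ b y _ _ hb _ hx =>
    rw [hx]
    exact fun h => hb ((Reflector.reduced_of_mul_iff hS).1 h)
  | cons _ b _ _ _ hb _ => exact fun h => (reduced_of_iff_not_follows hS).1 h hb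

theorem CellMatch.index_unique {p : {s : S // s ≠ 0} → Prop} {u r r' : List (Reflector S)}
    {i i' : ℕ} (h : CellMatch hS p u i r) (h' : CellMatch hS p u i' r') : i = i' := by
  induction h generalizing r' i' with
  | here p a x y l ha hx hy =>
    generalize hz : Reflector.of a = z at h'
    cases h' with
    | here _ b _ _ _ _ _ _ => rfl
    | cons _ b u i _ hb h' =>
      obtain rfl := Reflector.of_injective hS hz
      exact absurd hx h'.head_follows
  | cons p a u i r ha h ih =>
    generalize hz : Reflector.of a = z at h'
    cases h' with
    | here _ b x _ l hb hx hy =>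
      obtain rfl := Reflector.of_injective hS hz
      exact absurd hx h.head_follows
    | cons _ b u' i' _ hb h' =>
      obtain rfl := Reflector.of_injective hS hz
      rw [ih h']

theorem CellMatch.not_chained {p : {s : S // s ≠ 0} → Prop} {u r : List (Reflector S)} {i : ℕ}
    (h : CellMatch hS p u i r) : ¬ Chained p r := by
  induction h with
  | here p a x y l ha hx hy =>
    rintro ⟨⟩
    exact hx.of_mul_ne_of hS hy.symm
  | cons p a u i r ha h ih =>
    generalize hz : Reflector.of a = z
    rintro ⟨⟩
    rename_i b hb hl
    obtain rfl := Reflector.of_injective hS hz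
    exact ih hl

theorem CellMatch.not_cellMatch {p : {s : S // s ≠ 0} → Prop} {u r r' : List (Reflector S)}
    {i i' : ℕ} (h : CellMatch hS p u i r) : ¬ CellMatch hS p r i' r' := by
  induction h generalizing r' i' with
  | here p a x y l ha hx hy =>
    rintro ⟨⟩ <;> exact hx.of_mul_ne_of hS hy.symm
  | cons p a u i r ha h ih =>
    generalize hz : Reflector.of a = z
    intro h'
    cases h' with
    | here _ b x _ l hb hx hy =>
      obtain rfl := Reflector.of_injective hS hz
      exact h.head_follows' hx
    | cons _ b u' i' _ hb h' =>
      obtain rfl := Reflector.of_injective hS hz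
      exact ih h'

end Matching

/-! ### Collapsing the complex of the 0-reflector -/

section Collapse

variable {S : Type*} [SemigroupWithZero S] (hS : CategoricalAtZero S)

/-! ### Critical tuples and 0-tuples -/

theorem leftInvariant_true : LeftInvariant (fun _ : {s : S // s ≠ 0} => True) :=
  fun _ _ _ => Iff.rfl

/-- Nonzero consecutive products force a nonzero total product, by categoricity. The leading factor
`a` is carried along so that the induction can use the link between `a` and the first entry. -/
theorem Chained.exists_prod_ne_zero (hS : CategoricalAtZero S) {n : ℕ} {a : {s : S // s ≠ 0}}
    {v : Fin n → Reflector S} (h : Chained (Follows a) (List.ofFn v)) :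
    ∃ w : Fin n → {s : S // s ≠ 0}, (∀ i, Reflector.of (w i) = v i) ∧
      (a.1 : WithOne S) * (List.ofFn fun i => ((w i).1 : WithOne S)).prod ≠ ((0 : S) : WithOne S) := by
  induction n generalizing a with
  | zero =>
    refine ⟨fun i => i.elim0, fun i => i.elim0, ?_⟩
    simpa using a.2
  | succ n ih =>
    rw [List.ofFn_succ] at h
    generalize hx : v 0 = x at h
    cases h with
    | cons _ b _ hb hl =>
      obtain ⟨w, hw, hprod⟩ := ih hl
      refine ⟨Fin.cons b w, Fin.cases hx.symm hw, ?_⟩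
      rw [List.ofFn_succ, List.prod_cons]
      simp only [Fin.cons_zero, Fin.cons_succ]
      generalize (List.ofFn fun i => ((w i).1 : WithOne S)).prod = m at hprod
      cases m with
      | one => simpa [← WithOne.coe_mul, Follows] using hb
      | coe c =>
        rw [← WithOne.coe_mul, Ne, WithOne.coe_inj] at hprod
        rw [← WithOne.coe_mul, ← WithOne.coe_mul, Ne, WithOne.coe_inj]
        exact (hS.mul_mul_ne_zero_iff' hprod a.1).2 hb

theorem Chained.exists_toReflector_eq (hS : CategoricalAtZero S) {n : ℕ}
    {v : Fin n → Reflector S} (h : Chained (fun _ => True) (List.ofFn v)) :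
    ∃ w : ZeroTuples S n, w.toReflector = v := by
  cases n with
  | zero => exact ⟨⟨fun i => i.elim0, by simp [ProdNeZero]⟩, funext fun i => i.elim0⟩
  | succ n =>
    rw [List.ofFn_succ] at h
    generalize hx : v 0 = x at h
    cases h with
    | cons _ b _ _ hl =>
      obtain ⟨w, hw, hprod⟩ := hl.exists_prod_ne_zero hS
      refine ⟨⟨Fin.cons b.1 fun i => (w i).1, ?_⟩, funext (Fin.cases hx.symm hw)⟩
      rw [ProdNeZero, List.ofFn_succ, List.prod_cons]
      simpa only [Fin.cons_zero, Fin.cons_succ] using hprod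

theorem ZeroTuples.chained {n : ℕ} (w : ZeroTuples S n) (p : {s : S // s ≠ 0} → Prop)
    (hp : ∀ h : 0 < n, p ⟨w.1 ⟨0, h⟩, w.2.apply_ne_zero _⟩) :
    Chained p (List.ofFn w.toReflector) := by
  induction n generalizing p with
  | zero => exact Chained.nil p
  | succ n ih =>
    rw [List.ofFn_succ]
    refine Chained.cons p _ _ (hp n.succ_pos)
      (ih (⟨Fin.tail w.1, w.2.tail⟩ : ZeroTuples S n) _ fun h => ?_)
    cases n with
    | zero => exact absurd h (lt_irrefl 0)
    -- The product of the first two entries is the head of a face, which again has nonzero product.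
    | succ n => simpa [Fin.contractNth, Follows, Fin.tail] using (w.2.contractNth 0).head

theorem ZeroTuples.toReflector_injective (hS : CategoricalAtZero S) (n : ℕ) :
    Function.Injective (ZeroTuples.toReflector : ZeroTuples S n → _) := fun _ _ h =>
  Subtype.ext (funext fun i =>
    congrArg Subtype.val (Reflector.of_injective hS (congrFun h i)))

/-! ### Weights and the matching on tuples -/

/-- The sum of the lengths of the entries of a tuple. -/
noncomputable def tupleWeight {n : ℕ} (v : Fin n → Reflector S) : ℕ :=
  ((List.ofFn v).map (Reflector.length hS)).sum

theorem tupleWeight_tail_lt {n : ℕ} (v : Fin (n + 1) → Reflector S) :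
    tupleWeight hS (Fin.tail v) < tupleWeight hS v := by
  rw [tupleWeight, tupleWeight, List.ofFn_succ (f := v), List.map_cons, List.sum_cons]
  exact Nat.lt_add_of_pos_left (Reflector.length_pos hS _)

/-- `TupleMatch hS u i r`: the tuples `u` and `r` are matched, and `r` is the face number `i + 1`
of `u`. -/
def TupleMatch {n : ℕ} (u : Fin (n + 1) → Reflector S) (i : Fin (n + 1))
    (r : Fin n → Reflector S) : Prop :=
  CellMatch hS (fun _ => True) (List.ofFn u) i (List.ofFn r)

/-- The tuples which are matched with one of their faces. -/
def collapsibleTuples : (n : ℕ) → Set (Fin n → Reflector S)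
  | 0 => ∅
  | _ + 1 => {u | ∃ i r, TupleMatch hS u i r}

theorem CellMatch.mem_collapsibleTuples {n : ℕ} {u : Fin n → Reflector S} {i : ℕ}
    {r : List (Reflector S)} (h : CellMatch hS (fun _ => True) (List.ofFn u) i r) :
    u ∈ collapsibleTuples hS n := by
  have h1 := h.length_eq
  have h2 := h.lt_length
  rw [List.length_ofFn] at h1
  subst h1
  exact ⟨⟨i, by lia⟩, r.get, by rwa [TupleMatch, List.ofFn_get]⟩

theorem CellMatch.exists_tupleMatch {n : ℕ} {r : Fin n → Reflector S} {i : ℕ}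
    {u : List (Reflector S)} (h : CellMatch hS (fun _ => True) u i (List.ofFn r)) :
    ∃ u i, TupleMatch hS u i r := by
  have h1 := h.length_eq
  have h2 := h.lt_length
  rw [List.length_ofFn] at h1 h2
  obtain ⟨v, rfl⟩ : ∃ v : Fin (n + 1) → Reflector S, List.ofFn v = u := by
    exact ⟨fun k => u.get (Fin.cast h1.symm k),
      (List.ofFn_congr h1 u.get).symm.trans (List.ofFn_get u)⟩
  exact ⟨v, ⟨i, by lia⟩, h⟩

variable {hS}

theorem TupleMatch.contractNth_eq {n : ℕ} {u : Fin (n + 1) → Reflector S} {i : Fin (n + 1)}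
    {r : Fin n → Reflector S} (h : TupleMatch hS u i r) :
    Fin.contractNth i (· * ·) u = r :=
  List.ofFn_injective ((List.ofFn_contractNth i u).trans (CellMatch.contract_eq h))

theorem TupleMatch.tupleWeight_eq {n : ℕ} {u : Fin (n + 1) → Reflector S} {i : Fin (n + 1)}
    {r : Fin n → Reflector S} (h : TupleMatch hS u i r) : tupleWeight hS u = tupleWeight hS r :=
  CellMatch.sum_length_eq h

theorem TupleMatch.contractNth_of_ne {n : ℕ} {u : Fin (n + 1) → Reflector S} {i : Fin (n + 1)}
    {r : Fin n → Reflector S} (h : TupleMatch hS u i r) {j : Fin (n + 1)} (hj : j ≠ i) :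
    Chained (fun _ => True) (List.ofFn (Fin.contractNth j (· * ·) u)) ∨
      Fin.contractNth j (· * ·) u ∈ collapsibleTuples hS n := by
  obtain h1 | ⟨i', r', h1⟩ := CellMatch.contract_of_ne h leftInvariant_true j
    (fun h => hj (Fin.ext h))
  · exact Or.inl (by rwa [List.ofFn_contractNth])
  · exact Or.inr (CellMatch.mem_collapsibleTuples hS (by rwa [List.ofFn_contractNth]))

theorem TupleMatch.notMem_collapsibleTuples {n : ℕ} {u : Fin (n + 1) → Reflector S}
    {i : Fin (n + 1)} {r : Fin n → Reflector S} (h : TupleMatch hS u i r) :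
    r ∉ collapsibleTuples hS n := by
  cases n with
  | zero => exact Set.notMem_empty r
  | succ n =>
    rintro ⟨i', r', h'⟩
    exact CellMatch.not_cellMatch h h'

/-- Along its own matched index `v` determines `u` by uniqueness of the matching; along any other
index its face is critical or collapsible, and `r` is neither. -/
theorem TupleMatch.eq_of_contractNth_eq {n : ℕ} {u v : Fin (n + 1) → Reflector S}
    {i j : Fin (n + 1)} {r : Fin n → Reflector S} (h : TupleMatch hS u i r)
    (hv : v ∈ collapsibleTuples hS (n + 1)) (hj : Fin.contractNth j (· * ·) v = r) :
    v = u ∧ j = i := by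
  obtain ⟨k, t, hk⟩ := hv
  by_cases hjk : j = k
  · subst hjk
    obtain rfl := hk.contractNth_eq.symm.trans hj
    obtain rfl : v = u := List.ofFn_injective (CellMatch.left_unique hk h)
    exact ⟨rfl, Fin.ext (CellMatch.index_unique hk h)⟩
  · have h1 := hk.contractNth_of_ne hjk
    rw [hj] at h1
    exact (h1.elim (CellMatch.not_chained h) h.notMem_collapsibleTuples).elim

/-! ### Chains -/

variable (A : Type*) [AddCommGroup A]

theorem epsilonHom_injective (hS : CategoricalAtZero S) (n : ℕ) :
    Function.Injective (epsilonHom S A n) := by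
  have h : epsilonHom S A n =
      Finsupp.mapDomain.addMonoidHom (ZeroTuples.toReflector : ZeroTuples S n → _) := by
    refine Finsupp.addHom_ext fun v a => ?_
    rw [epsilonHom_single]
    exact (Finsupp.mapDomain_single).symm
  rw [h]
  exact Finsupp.mapDomain_injective (ZeroTuples.toReflector_injective hS n)

theorem single_mem_range_epsilonHom (hS : CategoricalAtZero S) {n : ℕ} {v : Fin n → Reflector S}
    (h : Chained (fun _ => True) (List.ofFn v)) (a : A) :
    Finsupp.single v a ∈ (epsilonHom S A n).range := by
  obtain ⟨w, rfl⟩ := h.exists_toReflector_eq hS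
  exact ⟨Finsupp.single w a, epsilonHom_single S A n w a⟩

theorem epsilonHom_apply_eq_zero {n : ℕ} {v : Fin n → Reflector S}
    (h : ¬ Chained (fun _ => True) (List.ofFn v)) (x : ZeroChains S A n) :
    epsilonHom S A n x v = 0 := by
  induction x using Finsupp.induction_linear with
  | zero => simp
  | add f g hf hg => rw [map_add, Finsupp.add_apply, hf, hg, add_zero]
  | single w a =>
    rw [epsilonHom_single, Finsupp.single_eq_of_ne]
    rintro rfl
    exact h (w.chained _ fun _ => trivial)

theorem epsilonHom_zero_surjective (hS : CategoricalAtZero S) :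
    Function.Surjective (epsilonHom S A 0) := by
  rw [← AddMonoidHom.range_eq_top, eq_top_iff]
  intro x _
  induction x using Finsupp.induction_linear with
  | zero => exact AddSubgroup.zero_mem _
  | add f g hf hg => exact AddSubgroup.add_mem _ (hf trivial) (hg trivial)
  | single v a => exact single_mem_range_epsilonHom A hS (by simpa using Chained.nil _) a

variable [ZeroModule S A]

variable (hS) in
/-- The chains which are sums of a 0-chain and a combination of collapsible tuples. -/
noncomputable def reducedChains (n : ℕ) : AddSubgroup (Chains (Reflector S) A n) :=
  (Finsupp.supported A ℤ (collapsibleTuples hS n)).toAddSubgroup ⊔ (epsilonHom S A n).range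

theorem exists_single_sub_boundary_mem {n : ℕ} (v : Fin n → Reflector S) (a : A) :
    ∃ y, Finsupp.single v a - boundary (Reflector S) A n y ∈ reducedChains hS A n := by
  have hU : ∀ (v : Fin n → Reflector S) (a : A), v ∈ collapsibleTuples hS n →
      Finsupp.single v a ∈ reducedChains hS A n := fun v a h =>
    AddSubgroup.mem_sup_left (Finsupp.single_mem_supported ℤ a h)
  have hD : ∀ (v : Fin n → Reflector S) (a : A), Chained (fun _ => True) (List.ofFn v) →
      Finsupp.single v a ∈ reducedChains hS A n := fun v a h =>
    AddSubgroup.mem_sup_right (single_mem_range_epsilonHom A hS h a)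
  induction hw : tupleWeight hS v using Nat.strong_induction_on generalizing v a with
  | _ w ih =>
    obtain h | ⟨u, i, h⟩ | ⟨i, r, h⟩ := chained_or_cellMatch_top hS (List.ofFn v)
    · exact ⟨0, by simpa using hD v a h⟩
    · obtain ⟨u, i, h⟩ := CellMatch.exists_tupleMatch hS h
      obtain ⟨y, hy⟩ := ih _ (by rw [← hw, ← h.tupleWeight_eq]; exact tupleWeight_tail_lt hS u)
        (Fin.tail u) ((-1 : ℤ) ^ ((i : ℕ) + 1) • RightModule.act a (u 0)) rfl
      refine ⟨(-1 : ℤ) ^ ((i : ℕ) + 1) • Finsupp.single u a - y, ?_⟩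
      rw [map_sub, map_zsmul, boundary_single, ← Finset.add_sum_erase _ _ (Finset.mem_univ i),
        h.contractNth_eq, smul_add, smul_add, smul_smul, ← mul_pow, neg_one_mul, neg_neg, one_pow,
        one_smul, Finsupp.smul_single]
      have hrest : (-1 : ℤ) ^ ((i : ℕ) + 1) • ∑ j ∈ Finset.univ.erase i, (-1 : ℤ) ^ ((j : ℕ) + 1) •
          Finsupp.single (Fin.contractNth j (· * ·) u) a ∈ reducedChains hS A n := by
        refine AddSubgroup.zsmul_mem _ (AddSubgroup.sum_mem _ fun j hj =>
          AddSubgroup.zsmul_mem _ ?_ _) _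
        exact (h.contractNth_of_ne (Finset.ne_of_mem_erase hj)).elim (hD _ a) (hU _ a)
      convert AddSubgroup.neg_mem _ (AddSubgroup.add_mem _ hy hrest) using 1
      abel
    · exact ⟨0, by simpa using hU v a (CellMatch.mem_collapsibleTuples hS h)⟩

theorem exists_sub_boundary_mem_reducedChains {n : ℕ} (x : Chains (Reflector S) A n) :
    ∃ y, x - boundary (Reflector S) A n y ∈ reducedChains hS A n := by
  induction x using Finsupp.induction_linear with
  | zero => exact ⟨0, by simp⟩
  | add f g hf hg =>
    obtain ⟨y, hy⟩ := hf
    obtain ⟨z, hz⟩ := hg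
    refine ⟨y + z, ?_⟩
    rw [map_add, add_sub_add_comm]
    exact AddSubgroup.add_mem _ hy hz
  | single v a => exact exists_single_sub_boundary_mem A v a

/-- Only `u` contributes at `r`: first faces of terms in the support are too light to equal `r`, and
other faces are excluded by `TupleMatch.eq_of_contractNth_eq`. -/
theorem boundary_apply_of_tupleMatch {n : ℕ} {u : Fin (n + 1) → Reflector S} {i : Fin (n + 1)}
    {r : Fin n → Reflector S} (h : TupleMatch hS u i r) {x : Chains (Reflector S) A (n + 1)}
    (hx : x ∈ Finsupp.supported A ℤ (collapsibleTuples hS (n + 1)))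
    (hmax : ∀ v ∈ x.support, tupleWeight hS v ≤ tupleWeight hS u) :
    boundary (Reflector S) A n x r = (-1 : ℤ) ^ ((i : ℕ) + 1) • x u := by
  classical
  rw [Finsupp.mem_supported] at hx
  have hterm : ∀ v ∈ x.support, boundary (Reflector S) A n (Finsupp.single v (x v)) r =
      if v = u then (-1 : ℤ) ^ ((i : ℕ) + 1) • x u else 0 := by
    intro v hv
    have htail : Fin.tail v ≠ r := fun h1 =>
      absurd (tupleWeight_tail_lt hS v) (by
        rw [h1, ← h.tupleWeight_eq]
        exact not_lt.2 (hmax v hv))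
    rw [boundary_single, Finsupp.add_apply, Finsupp.single_eq_of_ne htail.symm, zero_add,
      Finsupp.finsetSum_apply]
    simp only [Finsupp.smul_apply]
    split_ifs with hvu
    · subst hvu
      rw [Finset.sum_eq_single i]
      · rw [h.contractNth_eq, Finsupp.single_eq_same]
      · intro j _ hj
        rw [Finsupp.single_eq_of_ne, smul_zero]
        exact fun h1 => hj (h.eq_of_contractNth_eq (hx hv) h1.symm).2
      · exact fun h1 => absurd (Finset.mem_univ i) h1
    · refine Finset.sum_eq_zero fun j _ => ?_
      rw [Finsupp.single_eq_of_ne, smul_zero]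
      exact fun h1 => hvu (h.eq_of_contractNth_eq (hx hv) h1.symm).1
  conv_lhs => rw [← Finsupp.sum_single x, Finsupp.sum, map_sum, Finsupp.finsetSum_apply,
    Finset.sum_congr rfl hterm]
  rw [Finset.sum_ite_eq']
  split_ifs with h1
  · rfl
  · rw [Finsupp.notMem_support_iff.1 h1, smul_zero]

theorem eq_zero_of_boundary_mem_range {n : ℕ} {x : Chains (Reflector S) A (n + 1)}
    (hx : x ∈ Finsupp.supported A ℤ (collapsibleTuples hS (n + 1)))
    (h : boundary (Reflector S) A n x ∈ (epsilonHom S A n).range) : x = 0 := by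
  by_contra h0
  obtain ⟨u, hu, hmax⟩ := Finset.exists_max_image x.support (tupleWeight hS)
    (Finsupp.support_nonempty_iff.2 h0)
  obtain ⟨i, r, hm⟩ := (Finsupp.mem_supported _ _).1 hx hu
  obtain ⟨z, hz⟩ := h
  have h1 := boundary_apply_of_tupleMatch A hm hx hmax
  rw [← hz, epsilonHom_apply_eq_zero A (CellMatch.not_chained hm)] at h1
  have h2 := congrArg (fun a => (-1 : ℤ) ^ ((i : ℕ) + 1) • a) h1
  simp only [smul_zero, smul_smul, ← mul_pow, neg_one_mul, neg_neg, one_pow, one_smul] at h2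
  exact Finsupp.mem_support_iff.1 hu h2.symm

theorem exists_sub_boundary_mem_range (hS : CategoricalAtZero S) {n : ℕ}
    (x : Chains (Reflector S) A (n + 1))
    (hx : boundary (Reflector S) A n x ∈ (epsilonHom S A n).range) :
    ∃ y, x - boundary (Reflector S) A (n + 1) y ∈ (epsilonHom S A (n + 1)).range := by
  obtain ⟨y, hy⟩ := exists_sub_boundary_mem_reducedChains (hS := hS) A x
  obtain ⟨c, hc, e, ⟨z, rfl⟩, he⟩ := AddSubgroup.mem_sup.1 hy
  -- Modulo the boundary of `y`, the chain `x` is `c` plus a 0-chain, so the boundary of `c` is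
  -- again a 0-chain.
  have h0 : c = 0 := by
    refine eq_zero_of_boundary_mem_range A hc ?_
    rw [eq_sub_of_add_eq he, map_sub, map_sub, boundary_boundary, sub_zero, boundary_epsilonHom]
    exact AddSubgroup.sub_mem _ hx ⟨_, rfl⟩
  refine ⟨y, z, ?_⟩
  rw [← he, h0, zero_add]

end Collapse

/-! ### Isomorphisms in homology -/

theorem CategoryTheory.ShortComplex.ab_isIso_homologyMap {S₁ S₂ : ShortComplex Ab} (φ : S₁ ⟶ S₂)
    (hinj : ∀ x y, S₁.g x = 0 → φ.τ₂ x = S₂.f y → ∃ z, S₁.f z = x)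
    (hsurj : ∀ x, S₂.g x = 0 → ∃ x' y, S₁.g x' = 0 ∧ φ.τ₂ x' + S₂.f y = x) :
    IsIso (ShortComplex.homologyMap φ) := by
  have hcomp : ∀ {X Y Z : Ab} (f : X ⟶ Y) (g : Y ⟶ Z) (x : X), (f ≫ g) x = g (f x) :=
    fun f g x => ConcreteCategory.comp_apply f g x
  have hexact : ∀ T : ShortComplex Ab,
      (ShortComplex.mk T.toCycles T.homologyπ T.toCycles_comp_homologyπ).Exact := fun T =>
    ShortComplex.exact_of_g_is_cokernel _ T.homologyIsCokernel
  have hcycle : ∀ (T : ShortComplex Ab) (x : T.X₂), T.g x = 0 → ∃ c : T.cycles, T.iCycles c = x :=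
    fun T x hx => ⟨_, T.abCyclesIso_inv_apply_iCycles ⟨x, hx⟩⟩
  have hi : ∀ T : ShortComplex Ab, Function.Injective T.iCycles := fun T =>
    (AddCommGrpCat.mono_iff_injective _).1 inferInstance
  have hπ : ∀ T : ShortComplex Ab, Function.Surjective T.homologyπ := fun T =>
    (AddCommGrpCat.epi_iff_surjective _).1 inferInstance
  have hg : ∀ (T : ShortComplex Ab) (c : T.cycles), T.g (T.iCycles c) = 0 := fun T c => by
    rw [← hcomp, T.iCycles_g]
    rfl
  have hmap : ∀ c : S₁.cycles, S₂.iCycles (ShortComplex.cyclesMap φ c) = φ.τ₂ (S₁.iCycles c) :=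
    fun c => by rw [← hcomp, ShortComplex.cyclesMap_i, hcomp]
  have hto : ∀ (T : ShortComplex Ab) (x : T.X₁), T.iCycles (T.toCycles x) = T.f x :=
    fun T x => by rw [← hcomp, T.toCycles_i]
  have hnat : ∀ c : S₁.cycles, ShortComplex.homologyMap φ (S₁.homologyπ c) =
      S₂.homologyπ (ShortComplex.cyclesMap φ c) :=
    fun c => by rw [← hcomp, ShortComplex.homologyπ_naturality, hcomp]
  have hbd : ∀ (T : ShortComplex Ab) (x : T.X₁), T.homologyπ (T.toCycles x) = 0 := fun T x => by
    rw [← hcomp, T.toCycles_comp_homologyπ]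
    rfl
  rw [isIso_iff_mono_and_epi]
  constructor
  · rw [AddCommGrpCat.mono_iff_injective]
    refine (injective_iff_map_eq_zero _).2 fun h hh => ?_
    obtain ⟨c, rfl⟩ := hπ S₁ h
    rw [hnat] at hh
    obtain ⟨y, hy⟩ := (ShortComplex.ab_exact_iff _).1 (hexact S₂) _ hh
    obtain ⟨z, hz⟩ := hinj (S₁.iCycles c) y (hg _ _) (by
      rw [← hmap, ← hto]
      exact congrArg _ hy.symm)
    obtain rfl : S₁.toCycles z = c := hi S₁ ((hto S₁ z).trans hz)
    exact hbd S₁ z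
  · rw [AddCommGrpCat.epi_iff_surjective]
    intro h
    obtain ⟨c, rfl⟩ := hπ S₂ h
    obtain ⟨x, y, hx, hxy⟩ := hsurj (S₂.iCycles c) (hg _ _)
    obtain ⟨d, rfl⟩ := hcycle S₁ x hx
    refine ⟨S₁.homologyπ d, ?_⟩
    obtain rfl : ShortComplex.cyclesMap φ d + S₂.toCycles y = c := hi S₂ (by
      rw [map_add, hmap, hto, hxy])
    rw [map_add, hbd, add_zero, hnat]

/-- The hypotheses `hzero` and `hsucc` express acyclicity of the cokernel of the injective chain map
`φ`, without forming the quotient. -/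
theorem isIso_homologyMap_of_chains {K L : ChainComplex Ab ℕ} (φ : K ⟶ L) (n : ℕ)
    (hinj : ∀ n, Function.Injective (φ.f n)) (hzero : Function.Surjective (φ.f 0))
    (hsucc : ∀ n (x : L.X (n + 1)), (∃ z, φ.f n z = L.d (n + 1) n x) →
      ∃ y z, φ.f (n + 1) z + L.d (n + 2) (n + 1) y = x) :
    IsIso (HomologicalComplex.homologyMap φ n) := by
  have hcomp : ∀ {X Y Z : Ab} (f : X ⟶ Y) (g : Y ⟶ Z) (x : X), (f ≫ g) x = g (f x) :=
    fun f g x => ConcreteCategory.comp_apply f g x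
  have hcomm : ∀ i j (x : K.X i), L.d i j (φ.f i x) = φ.f j (K.d i j x) := fun i j x => by
    rw [← hcomp, φ.comm, hcomp]
  have hdd : ∀ i j k (x : L.X i), L.d j k (L.d i j x) = 0 := fun i j k x => by
    rw [← hcomp, L.d_comp_d]
    rfl
  have hsplit : ∀ (k : ℕ) (x : L.X n), (n = k + 1 ∨ n = 0) → L.d n k x = 0 →
      ∃ z y, φ.f n z + L.d (n + 1) n y = x := by
    intro k x hk hx
    cases n with
    | zero =>
      obtain ⟨z, rfl⟩ := hzero x
      exact ⟨z, 0, by rw [map_zero, add_zero]⟩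
    | succ n =>
      obtain rfl : k = n := by lia
      obtain ⟨y, z, h⟩ := hsucc k x ⟨0, by rw [hx, map_zero]⟩
      exact ⟨z, y, h⟩
  have hprev : (ComplexShape.down ℕ).prev n = n + 1 := ChainComplex.prev ℕ n
  have hnext : ∃ k, (ComplexShape.down ℕ).next n = k ∧ (n = k + 1 ∨ n = 0) := by
    cases n with
    | zero => exact ⟨_, rfl, Or.inr rfl⟩
    | succ n => exact ⟨n, ChainComplex.next_nat_succ n, Or.inl rfl⟩
  refine ShortComplex.ab_isIso_homologyMap
    ((HomologicalComplex.shortComplexFunctor Ab (ComplexShape.down ℕ) n).map φ) ?_ ?_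
  · change ∀ (x : K.X n) (y : L.X ((ComplexShape.down ℕ).prev n)),
      K.d n ((ComplexShape.down ℕ).next n) x = 0 →
        φ.f n x = L.d ((ComplexShape.down ℕ).prev n) n y →
          ∃ z, K.d ((ComplexShape.down ℕ).prev n) n z = x
    rw [hprev]
    intro x y _ hxy
    -- The bounding chain `y` has its boundary in the image of `φ`, so modulo a boundary it comes
    -- from some `z`, which then bounds `x`.
    obtain ⟨y', z, hz⟩ := hsucc n y ⟨x, hxy⟩
    refine ⟨z, hinj n ?_⟩
    rw [← hcomm, hxy, ← hz, map_add, hdd, add_zero]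
  · change ∀ x : L.X n, L.d n ((ComplexShape.down ℕ).next n) x = 0 →
      ∃ (x' : K.X n) (y : L.X ((ComplexShape.down ℕ).prev n)),
        K.d n ((ComplexShape.down ℕ).next n) x' = 0 ∧
          φ.f n x' + L.d ((ComplexShape.down ℕ).prev n) n y = x
    obtain ⟨k, hk, hnk⟩ := hnext
    rw [hprev, hk]
    intro x hx
    obtain ⟨z, y, h⟩ := hsplit k x hnk hx
    refine ⟨z, y, hinj k ?_, h⟩
    rw [← hcomm, eq_sub_of_add_eq h, map_sub, hx, hdd, sub_zero, map_zero]

theorem theorem2 {S : Type*} [SemigroupWithZero S] (hS : CategoricalAtZero S)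
    (A : Type*) [AddCommGroup A] [ZeroModule S A] (n : ℕ) :
    IsIso (HomologicalComplex.homologyMap (epsilon S A) n) := by
  refine isIso_homologyMap_of_chains (epsilon S A) n (epsilonHom_injective A hS)
    (epsilonHom_zero_surjective A hS) fun n x hx => ?_
  rw [chainComplex_d] at hx ⊢
  obtain ⟨y, z, hz⟩ := exists_sub_boundary_mem_range A hS x hx
  exact ⟨y, z, eq_sub_iff_add_eq.1 hz⟩
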